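/- Let $T : A \to O^*\times O^*$ be a graphical signature ($O$, $A$ sets, $O^*$ the finite words in $O$). Its typegraph $T_{\mathcal G}$ has point set $O+A$, a self-loop at each $o\in O$, and for each $a\in A$ with $T(a)=(D,C)$ one edge from $d$ to $a$ for each letter occurrence $d$ in $D$ and one edge from $a$ to $c$ for each letter occurrence $c$ in $C$. A *typed open-graph* is a directed multigraph $G$ with a graph map $\tau:G\to T_{\mathcal G}$ such that at every vertex (a point with $\tau$-value in $A$) $\tau$ restricts to a bijection of the sets of adjacent edges, and every edge-point (a point with $\tau$-value in $O$) has at most one in-edge and at most one out-edge. Typed open-graphs form a full subcategory $\mathbf{OGraph}_{T_{\mathcal G}}$ of $\mathbf{Graph}/T_{\mathcal G}$. $\mathrm{In}(G)$ (resp. $\mathrm{Out}(G)$) is the set of edge-points without in-edges (resp. out-edges); an isolated point is a point of $\mathrm{In}(G)\cap\mathrm{Out}(G)$. A pushout in $\mathbf{OGraph}_{T_{\mathcal G}}$ is *adhesive* if it is preserved by the embedding into $\mathbf{Graph}/T_{\mathcal G}$. A *rewrite rule* $L\rightsquigarrow R$ is a span of monomorphisms $L \xleftarrow{b_1} B \xrightarrow{b_2}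 R$ in $\mathbf{OGraph}_{T_{\mathcal G}}$, where $B$ has no edges and its points split into two parts which both $b_1$ and $b_2$ map bijectively onto the inputs, respectively the outputs, of $L$ and of $R$. A *matching* of the rule on $G$ is a monomorphism $m:L\to G$ such that $B\to L\to G$ has an adhesive pushout complement $B\to K\xrightarrow{s} G$; then $G[L\rightsquigarrow R]_m$ is the adhesive pushout of $K\leftarrow B\to R$, with $s':K\to G[L\rightsquigarrow R]_m$. For words $X,Y\in O^*$, regarded as edgeless graphs of typed points, a *directed cospan* $\mathcal G:X\to Y$ is a pair of maps $Y\xrightarrow{c} G\xleftarrow{d} X$ in $\mathbf{OGraph}_{T_{\mathcal G}}$, where $d$ is a bijection of $X$ onto $\mathrm{In}(G)$ and $c$ a bijection of $Y$ onto $\mathrm{Out}(G)$. Composition $\mathcal H\circ\mathcal G$ is by pushout in $\mathbf{OGraph}_{T_{\mathcal G}}$ over the shared word, the identity of $X$ is $X\xrightarrow{1}X\xleftarrow{1}X$, and $\cong$ is isomorphism of graphs commuting with both legs. For a matching $m$ on $G$, $\mathcal G[L\rightsquigarrow R]_m$ is the directed cospan $X\to Y$ on $G[L\rightsquigarrow R]_m$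 with legs $s'd'$, $s'c'$, where $sd'=d$, $sc'=c$. **Theorem.** Composites of directed cospans, and the cospan $\mathcal G[L\rightsquigarrow R]_m$ for every matching $m$ on $G$, exist and are unique up to isomorphism of cospans. Let $\mathcal G:X\to Y$ and $\mathcal H:Y\to Z$ be directed cospans of typed open-graphs. For every rule $L\rightsquigarrow R$ and every matching $m$ of it on $\mathcal G$ there is a matching $m'$ on $\mathcal H\circ\mathcal G$ with $$\mathcal H\circ(\mathcal G[L\rightsquigarrow R]_m)\cong(\mathcal H\circ\mathcal G)[L\rightsquigarrow R]_{m'},$$ and for every matching $n$ of it on $\mathcal H$ there is a matching $n'$ on $\mathcal H\circ\mathcal G$ with $$(\mathcal H[L\rightsquigarrow R]_n)\circ\mathcal G\cong(\mathcal H\circ\mathcal G)[L\rightsquigarrow R]_{n'}.$$ Consequently, for every set $\mathbb S$ of rewrite rules, the equivalence relation on directed cospans generated by isomorphism and by rewriting with rules of $\mathbb S$ is a congruence for composition, and the words in $O^*$ with the equivalence classes of cospans as arrows, composition induced by composition of cospans, and the classes of the identity cospans as identities, form a category (the rewrite category of $\mathbb S$). Moreover, composites of cospans whose graphs have no isolated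 points have none, and the graph of $\mathcal G$ has no isolated points if and only if that of $\mathcal G[L\rightsquigarrow R]_m$ has none. -/

import Mathlib

open CategoryTheory CategoryTheory.Limits

universe u

namespace TypedOpenGraph

/-- Directed multigraphs, as functors from `E ⇉ P` to sets: `zero` is the object of edges,
`one` the object of points, `left` is the source map and `right` the target map. -/
abbrev Graph : Type (u + 1) := WalkingParallelPair ⥤ Type u

namespace Graph

abbrev Points (G : Graph.{u}) : Type u := G.obj .one

abbrev Edges (G : Graph.{u}) : Type u := G.obj .zero

abbrev src (G : Graph.{u}) (e : G.Edges) : G.Points := G.map .left e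

abbrev tgt (G : Graph.{u}) (e : G.Edges) : G.Points := G.map .right e

/-- The edge neighbourhood `N(p)`: the set of edges adjacent to the point `p`. -/
def nbhd (G : Graph.{u}) (p : G.Points) : Set G.Edges := {e | G.src e = p ∨ G.tgt e = p}

end Graph

section Signature

variable {O A : Type u} (T : A → List O × List O)

/-- Edges of the typegraph: a self-loop for every `o : O`, and for every `a : A` one edge for each
position of the input word and one for each position of the output word of `a`. -/
inductive TypeEdge : Type u
  | loop (o : O)
  | input (a : A) (k : Fin (T a).1.length)
  | output (a : A) (k : Fin (T a).2.length)

namespace TypeEdge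

variable {T}

def src : TypeEdge T → O ⊕ A
  | loop o => .inl o
  | input a k => .inl ((T a).1.get k)
  | output a _ => .inr a

def tgt : TypeEdge T → O ⊕ A
  | loop o => .inl o
  | input a _ => .inr a
  | output a k => .inl ((T a).2.get k)

end TypeEdge

/-- The typegraph of the graphical signature `T : A → O* × O*`; its points are `O + A`. -/
def typeGraph : Graph.{u} :=
  parallelPair (TypeCat.ofHom (TypeEdge.src (T := T))) (TypeCat.ofHom (TypeEdge.tgt (T := T)))

/-- Graphs typed by the typegraph: the slice category over it. -/
abbrev TGraph : Type (u + 1) := Over (typeGraph T)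

variable {T}

namespace TGraph

def typeOf (G : TGraph T) (p : G.left.Points) : O ⊕ A := G.hom.app .one p

def IsEdgePoint (G : TGraph T) (p : G.left.Points) : Prop := ∃ o : O, G.typeOf p = .inl o

def IsVertex (G : TGraph T) (p : G.left.Points) : Prop := ∃ a : A, G.typeOf p = .inr a

/-- A graph map out of a typed graph is a local isomorphism if at every vertex it restricts to a
bijection of edge neighbourhoods. -/
def IsLocalIso (G : TGraph T) {H : Graph.{u}} (f : G.left ⟶ H) : Prop :=
  ∀ p : G.left.Points, G.IsVertex p →
    Set.BijOn (fun e : G.left.Edges => f.app .zero e) (G.left.nbhd p) (H.nbhd (f.app .one p))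

/-- `In(G)`: the edge-points without in-edges. -/
def inputs (G : TGraph T) : Set G.left.Points :=
  {p | G.IsEdgePoint p ∧ ∀ e, G.left.tgt e ≠ p}

/-- `Out(G)`: the edge-points without out-edges. -/
def outputs (G : TGraph T) : Set G.left.Points :=
  {p | G.IsEdgePoint p ∧ ∀ e, G.left.src e ≠ p}

/-- A typed graph is a typed open-graph if its typing map is a local isomorphism and every
edge-point has at most one in-edge and at most one out-edge. -/
structure IsOpen (G : TGraph T) : Prop where
  localIso : G.IsLocalIso G.hom
  in_unique : ∀ p, G.IsEdgePoint p → ∀ e e', G.left.tgt e = p → G.left.tgt e' = p → e = e'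
  out_unique : ∀ p, G.IsEdgePoint p → ∀ e e', G.left.src e = p → G.left.src e' = p → e = e'

/-- Maps of typed graphs whose typing maps are local isomorphisms are automatically local
isomorphisms, so that typed open-graphs and local isomorphisms form a full subcategory. -/
theorem isLocalIso_of_hom {G H : TGraph T} (hG : G.IsLocalIso G.hom) (hH : H.IsLocalIso H.hom)
    (f : G ⟶ H) : G.IsLocalIso f.left := by
  intro p hp
  have hw1 : ∀ q, H.hom.app .one (f.left.app .one q) = G.hom.app .one q := fun q =>
    ConcreteCategory.congr_hom (congrArg (fun a => NatTrans.app a WalkingParallelPair.one)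
      (Over.w f)) q
  have hw0 : ∀ q, H.hom.app .zero (f.left.app .zero q) = G.hom.app .zero q := fun q =>
    ConcreteCategory.congr_hom (congrArg (fun a => NatTrans.app a WalkingParallelPair.zero)
      (Over.w f)) q
  have hv : H.IsVertex (f.left.app .one p) := by
    obtain ⟨a, ha⟩ := hp
    exact ⟨a, (hw1 p).trans ha⟩
  have h1 := hG p hp
  have h2 := hH _ hv
  rw [hw1 p] at h2
  have hmaps : Set.MapsTo (fun e : G.left.Edges => f.left.app .zero e) (G.left.nbhd p)
      (H.left.nbhd (f.left.app .one p)) := by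
    rintro e (he | he)
    · left
      rw [← he]
      exact (ConcreteCategory.congr_hom (f.left.naturality .left) e).symm
    · right
      rw [← he]
      exact (ConcreteCategory.congr_hom (f.left.naturality .right) e).symm
  refine ⟨hmaps, ?_, ?_⟩
  · intro e he e' he' hee
    refine h1.injOn he he' ?_
    have := congrArg (fun x => H.hom.app .zero x) hee
    simpa only [hw0] using this
  · intro e he
    obtain ⟨e', he', hee⟩ := h1.surjOn (h2.mapsTo he)
    refine ⟨e', he', h2.injOn (hmaps he') he ?_⟩
    simpa only [hw0] using hee

end TGraph

variable (T)

/-- The category of typed open-graphs. -/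
abbrev OGraph : Type (u + 1) :=
  ObjectProperty.FullSubcategory (fun G : TGraph T => G.IsOpen)

/-- The embedding of typed open-graphs into typed graphs. -/
abbrev embedding : OGraph T ⥤ TGraph T :=
  ObjectProperty.ι (fun G : TGraph T => G.IsOpen)

variable {T}

namespace OGraph

abbrev Points (G : OGraph T) : Type u := G.obj.left.Points

abbrev Edges (G : OGraph T) : Type u := G.obj.left.Edges

abbrev inputs (G : OGraph T) : Set G.Points := G.obj.inputs

abbrev outputs (G : OGraph T) : Set G.Points := G.obj.outputs

/-- The action of a morphism of typed open-graphs on points. -/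
def onPoints {G H : OGraph T} (f : G ⟶ H) (p : G.Points) : H.Points := f.hom.left.app .one p

/-- No edge-point is both an input and an output. -/
def NoIsolatedPoints (G : OGraph T) : Prop := Disjoint G.inputs G.outputs

end OGraph

/-- A square of typed open-graphs is an adhesive pushout if it is a pushout and this pushout is
preserved by the embedding into typed graphs. -/
structure IsAdhesivePushout {Z X Y P : OGraph T} (f : Z ⟶ X) (g : Z ⟶ Y) (inl : X ⟶ P)
    (inr : Y ⟶ P) : Prop where
  isPushout : IsPushout f g inl inr
  preserved : IsPushout ((embedding T).map f) ((embedding T).map g) ((embedding T).map inl)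
    ((embedding T).map inr)

variable (T)

/-- A rewrite rule `L ← B → R`: a span of monomorphisms by which `L` and `R` share the same
boundary `B`. That is, `B` is a point-graph that splits into an input part `I` and its complement,
`b₁` identifies `I` with `In(L)` and the complement with `Out(L)`, and `b₂` identifies the same `I`
with `In(R)` and the same complement with `Out(R)`. -/
structure RewriteRule : Type (u + 1) where
  L : OGraph T
  B : OGraph T
  R : OGraph T
  b₁ : B ⟶ L
  b₂ : B ⟶ R
  mono₁ : Mono b₁
  mono₂ : Mono b₂
  noEdges : IsEmpty B.Edges
  sameBoundary : ∃ I : Set B.Points,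
    Set.BijOn (OGraph.onPoints b₁) I L.inputs ∧ Set.BijOn (OGraph.onPoints b₁) Iᶜ L.outputs ∧
    Set.BijOn (OGraph.onPoints b₂) I R.inputs ∧ Set.BijOn (OGraph.onPoints b₂) Iᶜ R.outputs

variable {T}

/-- A matching of the rule `ρ` on `G`: a monomorphism `m : L ⟶ G` such that `B ⟶ L ⟶ G` has an
adhesive pushout complement. -/
def IsMatching (ρ : RewriteRule T) {G : OGraph T} (m : ρ.L ⟶ G) : Prop :=
  Mono m ∧ ∃ (G' : OGraph T) (k : ρ.B ⟶ G') (s : G' ⟶ G), IsAdhesivePushout ρ.b₁ k m s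

variable (T)

/-- The point-graph of a word: one isolated point for each letter, typed by that letter. -/
def pointGraph (X : List O) : OGraph T where
  obj := Over.mk (Y := (parallelPair (TypeCat.ofHom PEmpty.elim) (TypeCat.ofHom PEmpty.elim) :
      Graph.{u}))
    (parallelPairHom (X := PEmpty.{u + 1}) (Y := ULift.{u} (Fin X.length))
      (TypeCat.ofHom PEmpty.elim) (TypeCat.ofHom PEmpty.elim)
      (TypeCat.ofHom (TypeEdge.src (T := T))) (TypeCat.ofHom (TypeEdge.tgt (T := T)))
      (TypeCat.ofHom PEmpty.elim)
      (TypeCat.ofHom fun i => Sum.inl (X.get i.down))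
      (by ext e; exact e.elim) (by ext e; exact e.elim))
  property :=
    { localIso := by
        rintro p ⟨a, ha⟩
        exact absurd ha Sum.inl_ne_inr
      in_unique := fun _ _ e => PEmpty.elim e
      out_unique := fun _ _ e => PEmpty.elim e }

/-- A directed cospan `X → G ← Y` from the word `X` to the word `Y`: `dom` is the inclusion of
`In(G) ≅ X` and `cod` is the inclusion of `Out(G) ≅ Y`. Isolated points are allowed, since the
identity cospans have them. -/
structure DCospan (X Y : List O) : Type (u + 1) where
  graph : OGraph T
  dom : pointGraph T X ⟶ graph
  cod : pointGraph T Y ⟶ graph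
  dom_bij : Set.BijOn (OGraph.onPoints dom) Set.univ graph.inputs
  cod_bij : Set.BijOn (OGraph.onPoints cod) Set.univ graph.outputs

variable {T}

namespace DCospan

variable {X Y Z : List O}

/-- Isomorphism of cospans: an isomorphism of typed graphs that commutes with both legs. -/
def Iso (𝒢 ℋ : DCospan T X Y) : Prop :=
  ∃ e : 𝒢.graph ≅ ℋ.graph, 𝒢.dom ≫ e.hom = ℋ.dom ∧ 𝒢.cod ≫ e.hom = ℋ.cod

/-- `𝒦` is a composite `ℋ ∘ 𝒢`: its graph is a pushout of the graphs of `𝒢` and `ℋ` over the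
shared word `Y`, and its legs are the outer legs of `𝒢` and `ℋ`. -/
def IsComp (𝒢 : DCospan T X Y) (ℋ : DCospan T Y Z) (𝒦 : DCospan T X Z) : Prop :=
  ∃ (i : 𝒢.graph ⟶ 𝒦.graph) (j : ℋ.graph ⟶ 𝒦.graph),
    IsPushout 𝒢.cod ℋ.dom i j ∧ 𝒦.dom = 𝒢.dom ≫ i ∧ 𝒦.cod = ℋ.cod ≫ j

/-- `𝒢'` is the cospan `𝒢[L ⇝ R]_m`: its graph is obtained by the double pushout of adhesive
pushouts, and the legs of `𝒢` and of `𝒢'` are induced by the same maps into the complement `K`. -/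
def IsRewrite (ρ : RewriteRule T) (𝒢 : DCospan T X Y) (m : ρ.L ⟶ 𝒢.graph)
    (𝒢' : DCospan T X Y) : Prop :=
  IsMatching ρ m ∧
  ∃ (K : OGraph T) (k : ρ.B ⟶ K) (s : K ⟶ 𝒢.graph) (s' : K ⟶ 𝒢'.graph) (n : ρ.R ⟶ 𝒢'.graph),
    IsAdhesivePushout ρ.b₁ k m s ∧ IsAdhesivePushout ρ.b₂ k n s' ∧
    (∃ d' : pointGraph T X ⟶ K, d' ≫ s = 𝒢.dom ∧ d' ≫ s' = 𝒢'.dom) ∧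
    ∃ c' : pointGraph T Y ⟶ K, c' ≫ s = 𝒢.cod ∧ c' ≫ s' = 𝒢'.cod

/-- `𝒢` rewrites to `ℋ` in one step of the rewrite system `𝕊`. -/
def RewritesTo (𝕊 : Set (RewriteRule T)) (𝒢 ℋ : DCospan T X Y) : Prop :=
  ∃ ρ ∈ 𝕊, ∃ (m : ρ.L ⟶ 𝒢.graph) (𝒢' : DCospan T X Y), IsRewrite ρ 𝒢 m 𝒢' ∧ Iso 𝒢' ℋ

/-- The closure of rewriting to an equivalence relation; isomorphic cospans are identified. -/
def RewriteEquiv (𝕊 : Set (RewriteRule T)) : DCospan T X Y → DCospan T X Y → Prop :=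
  Relation.EqvGen fun 𝒢 ℋ => Iso 𝒢 ℋ ∨ RewritesTo 𝕊 𝒢 ℋ

/-- The identity cospan of a word. -/
def identity (X : List O) : DCospan T X X where
  graph := pointGraph T X
  dom := 𝟙 _
  cod := 𝟙 _
  dom_bij := ⟨fun i _ => ⟨⟨X.get i.down, rfl⟩, fun e => PEmpty.elim e⟩, fun _ _ _ _ h => h,
    fun i _ => ⟨i, trivial, rfl⟩⟩
  cod_bij := ⟨fun i _ => ⟨⟨X.get i.down, rfl⟩, fun e => PEmpty.elim e⟩, fun _ _ _ _ h => h,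
    fun i _ => ⟨i, trivial, rfl⟩⟩

end DCospan

/-- The arrows `X → Y` of the rewrite category of `𝕊`: classes of cospans under rewriting. -/
def RewriteHom (𝕊 : Set (RewriteRule T)) (X Y : List O) : Type (u + 1) :=
  Quotient (Relation.EqvGen.setoid
    fun 𝒢 ℋ : DCospan T X Y => DCospan.Iso 𝒢 ℋ ∨ DCospan.RewritesTo 𝕊 𝒢 ℋ)

/-- The class of a cospan in the rewrite category. -/
def RewriteHom.mk (𝕊 : Set (RewriteRule T)) {X Y : List O} (𝒢 : DCospan T X Y) :
    RewriteHom 𝕊 X Y :=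
  Quotient.mk _ 𝒢

end Signature

end TypedOpenGraph

/-! All pushouts involved are over a graph of edge-points without edges, along maps injective on
points. In typed graphs such a pushout is a union of its two sides, overlapping exactly in the glued
points, with disjoint edge sets (`IsDiscrete.isGluing`). Vertices are never glued, so the pushout is
open once at every glued point at most one side has in-edges and at most one has out-edges
(`IsGluing.isOpen`).

For composition this holds because the shared points are outputs of the first graph and inputs of
the second. For rewriting, an input of `L` on the boundary is not an output, so `L` has an out-edge
there and the complement `K` has none; dually at outputs. Hence `R` fits into `K` as `L` did. The
inputs and outputs of the result depend only on `K`, `B → K` and the partition of `B`, not on `L` or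
`R` (`IsBoundary.inputs_eq`), which gives the legs of the rewritten cospan and the claim on isolated
points.

For compatibility with composition, let `K'` be `K` glued to the other cospan along the shared word.
Pasting pushouts shows that `K'` is a complement of the match in the composite and that gluing `R`
into `K'` gives the composite with the rewritten cospan (`isPushout_extend`). Congruence and the
category laws follow formally. -/

namespace TypedOpenGraph

variable {O A : Type u} {T : A → List O × List O}

/-! ### Elementwise description of maps of typed graphs -/

namespace TGraph

/-- The action of a map of typed graphs on points. -/
def pt {G H : TGraph T} (f : G ⟶ H) (p : G.left.Points) : H.left.Points := f.left.app .one p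

/-- The action of a map of typed graphs on edges. -/
def ed {G H : TGraph T} (f : G ⟶ H) (e : G.left.Edges) : H.left.Edges := f.left.app .zero e

theorem src_ed {G H : TGraph T} (f : G ⟶ H) (e : G.left.Edges) :
    H.left.src (ed f e) = pt f (G.left.src e) :=
  (ConcreteCategory.congr_hom (f.left.naturality .left) e).symm

theorem tgt_ed {G H : TGraph T} (f : G ⟶ H) (e : G.left.Edges) :
    H.left.tgt (ed f e) = pt f (G.left.tgt e) :=
  (ConcreteCategory.congr_hom (f.left.naturality .right) e).symm

theorem typeOf_pt {G H : TGraph T} (f : G ⟶ H) (p : G.left.Points) :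
    H.typeOf (pt f p) = G.typeOf p :=
  ConcreteCategory.congr_hom (congrArg (fun a => NatTrans.app a WalkingParallelPair.one)
    (Over.w f)) p

theorem hom_ed {G H : TGraph T} (f : G ⟶ H) (e : G.left.Edges) :
    H.hom.app .zero (ed f e) = G.hom.app .zero e :=
  ConcreteCategory.congr_hom (congrArg (fun a => NatTrans.app a WalkingParallelPair.zero)
    (Over.w f)) e

theorem isEdgePoint_pt {G H : TGraph T} (f : G ⟶ H) (p : G.left.Points) :
    H.IsEdgePoint (pt f p) ↔ G.IsEdgePoint p := by
  simp only [IsEdgePoint, typeOf_pt]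

theorem isVertex_pt {G H : TGraph T} (f : G ⟶ H) (p : G.left.Points) :
    H.IsVertex (pt f p) ↔ G.IsVertex p := by
  simp only [IsVertex, typeOf_pt]

theorem IsEdgePoint.not_isVertex {G : TGraph T} {p : G.left.Points} (h : G.IsEdgePoint p) :
    ¬ G.IsVertex p := by
  rintro ⟨a, ha⟩
  obtain ⟨o, ho⟩ := h
  exact Sum.inl_ne_inr (ho.symm.trans ha)

theorem hom_ext {G H : TGraph T} {f g : G ⟶ H} (h₁ : ∀ p, pt f p = pt g p)
    (h₀ : ∀ e, ed f e = ed g e) : f = g := by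
  apply Over.OverMorphism.ext
  apply NatTrans.ext
  funext j
  cases j
  · exact ConcreteCategory.hom_ext _ _ h₀
  · exact ConcreteCategory.hom_ext _ _ h₁

/-- A map of typed graphs from its actions on points and edges. -/
def mkHom {G H : TGraph T} (φ₁ : G.left.Points → H.left.Points) (φ₀ : G.left.Edges → H.left.Edges)
    (hs : ∀ e, H.left.src (φ₀ e) = φ₁ (G.left.src e))
    (ht : ∀ e, H.left.tgt (φ₀ e) = φ₁ (G.left.tgt e))
    (h₁ : ∀ p, H.typeOf (φ₁ p) = G.typeOf p)
    (h₀ : ∀ e, H.hom.app .zero (φ₀ e) = G.hom.app .zero e) : G ⟶ H :=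
  Over.homMk
    { app := fun j => match j with
        | .zero => TypeCat.ofHom φ₀
        | .one => TypeCat.ofHom φ₁
      naturality := by
        rintro _ _ (_ | _ | _)
        · exact ConcreteCategory.hom_ext _ _ fun e => (hs e).symm
        · exact ConcreteCategory.hom_ext _ _ fun e => (ht e).symm
        · simp }
    (by
      apply NatTrans.ext
      funext j
      cases j
      · exact ConcreteCategory.hom_ext _ _ h₀
      · exact ConcreteCategory.hom_ext _ _ h₁)

/-- A map whose values lie in the image of an injective map factors through the latter. -/
theorem exists_factor {X K G : TGraph T} (s : K ⟶ G) (f : X ⟶ G)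
    (hp : Function.Injective (pt s))
    (hfp : ∀ x, ∃ y, pt s y = pt f x) (hfe : ∀ x, ∃ y, ed s y = ed f x) :
    ∃ φ : X ⟶ K, φ ≫ s = f := by
  choose φ₁ hφ₁ using hfp
  choose φ₀ hφ₀ using hfe
  refine ⟨mkHom φ₁ φ₀ (fun e => hp ?_) (fun e => hp ?_) (fun p => ?_) (fun e => ?_),
    hom_ext hφ₁ hφ₀⟩
  · rw [← src_ed, hφ₀, hφ₁, src_ed]
  · rw [← tgt_ed, hφ₀, hφ₁, tgt_ed]
  · rw [← typeOf_pt s, hφ₁, typeOf_pt]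
  · rw [← hom_ed s, hφ₀, hom_ed]

theorem mono_of_injective {G H : TGraph T} (f : G ⟶ H) (hp : Function.Injective (pt f))
    (he : Function.Injective (ed f)) : Mono f where
  right_cancellation _ _ w := hom_ext
    (fun p => hp (congrArg (fun a => pt a p) w)) (fun e => he (congrArg (fun a => ed a e) w))

/-- The point `p` has no in-edges. -/
def NoIn (G : TGraph T) (p : G.left.Points) : Prop := ∀ e, G.left.tgt e ≠ p

/-- The point `p` has no out-edges. -/
def NoOut (G : TGraph T) (p : G.left.Points) : Prop := ∀ e, G.left.src e ≠ p

theorem NoIn.of_pt {G H : TGraph T} (f : G ⟶ H) {p : G.left.Points} (h : H.NoIn (pt f p)) :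
    G.NoIn p := fun e he => h (ed f e) (by rw [tgt_ed, he])

theorem NoOut.of_pt {G H : TGraph T} (f : G ⟶ H) {p : G.left.Points} (h : H.NoOut (pt f p)) :
    G.NoOut p := fun e he => h (ed f e) (by rw [src_ed, he])

/-! ### Pushouts over discrete graphs as gluings -/

/-- Graphs of edge-points without edges. -/
structure IsDiscrete (G : TGraph T) : Prop where
  noEdges : IsEmpty G.left.Edges
  edgePoint : ∀ p, G.IsEdgePoint p

/-- An explicit description of the pushout of two injective maps out of a discrete graph. -/
structure IsGluing {Z X Y P : TGraph T} (f : Z ⟶ X) (g : Z ⟶ Y) (inl : X ⟶ P) (inr : Y ⟶ P) :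
    Prop where
  pt_w : ∀ z, pt inl (pt f z) = pt inr (pt g z)
  inl_inj : Function.Injective (pt inl)
  inr_inj : Function.Injective (pt inr)
  inl_inj_ed : Function.Injective (ed inl)
  inr_inj_ed : Function.Injective (ed inr)
  exists_of_eq : ∀ x y, pt inl x = pt inr y → ∃ z, pt f z = x ∧ pt g z = y
  ed_ne : ∀ e e', ed inl e ≠ ed inr e'
  cover : ∀ p, (∃ x, pt inl x = p) ∨ ∃ y, pt inr y = p
  cover_ed : ∀ e, (∃ x, ed inl x = e) ∨ ∃ y, ed inr y = e

/-- Pushouts in the slice are computed on points and on edges separately, as pushouts of sets along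
injections. On edges the apex is empty, so that pushout is a disjoint union. -/
theorem IsDiscrete.isGluing {Z X Y P : TGraph T} {f : Z ⟶ X} {g : Z ⟶ Y} {inl : X ⟶ P}
    {inr : Y ⟶ P} (hZ : Z.IsDiscrete) (hf : Function.Injective (pt f))
    (hg : Function.Injective (pt g)) (h : IsPushout f g inl inr) : IsGluing f g inl inr := by
  have hE := hZ.noEdges
  have h₁ := h.map (Over.forget _ ⋙ (evaluation _ _).obj WalkingParallelPair.one)
  have h₀ := h.map (Over.forget _ ⋙ (evaluation _ _).obj WalkingParallelPair.zero)
  have hfe : Function.Injective (ed f) := fun e => hE.elim e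
  have hge : Function.Injective (ed g) := fun e => hE.elim e
  refine
    { pt_w := fun z => congrArg (fun a => pt a z) h.w
      inl_inj := Types.pushoutCocone_inr_injective_of_isColimit h₁.flip.isColimit hg
      inr_inj := Types.pushoutCocone_inr_injective_of_isColimit h₁.isColimit hf
      inl_inj_ed := Types.pushoutCocone_inr_injective_of_isColimit h₀.flip.isColimit hge
      inr_inj_ed := Types.pushoutCocone_inr_injective_of_isColimit h₀.isColimit hfe
      exists_of_eq := fun x y =>
        (Types.pushoutCocone_inl_eq_inr_iff_of_isColimit h₁.isColimit hf x y).1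
      ed_ne := fun e e' hee => ?_
      cover := Types.eq_or_eq_of_isPushout h₁
      cover_ed := Types.eq_or_eq_of_isPushout h₀ }
  obtain ⟨z, -⟩ :=
    (Types.pushoutCocone_inl_eq_inr_iff_of_isColimit h₀.isColimit hfe e e').1 hee
  exact hE.elim z

namespace IsGluing

variable {Z X Y P : TGraph T} {f : Z ⟶ X} {g : Z ⟶ Y} {inl : X ⟶ P} {inr : Y ⟶ P}

theorem flip (h : IsGluing f g inl inr) : IsGluing g f inr inl where
  pt_w z := (h.pt_w z).symm
  inl_inj := h.inr_inj
  inr_inj := h.inl_inj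
  inl_inj_ed := h.inr_inj_ed
  inr_inj_ed := h.inl_inj_ed
  exists_of_eq x y hxy := by
    obtain ⟨z, h₁, h₂⟩ := h.exists_of_eq y x hxy.symm
    exact ⟨z, h₂, h₁⟩
  ed_ne e e' := (h.ed_ne e' e).symm
  cover p := (h.cover p).symm
  cover_ed e := (h.cover_ed e).symm

/-- An edge of `P` comes from `X` or from `Y`; in the second case it can end at a point of `X` only
if that point is glued. -/
theorem noIn_inl_iff (h : IsGluing f g inl inr) (x : X.left.Points) :
    P.NoIn (pt inl x) ↔ X.NoIn x ∧ ∀ z, pt f z = x → Y.NoIn (pt g z) := by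
  refine ⟨fun hx => ⟨hx.of_pt, ?_⟩, fun ⟨h₁, h₂⟩ e he => ?_⟩
  · rintro z rfl
    rw [h.pt_w] at hx
    exact hx.of_pt
  · obtain ⟨e, rfl⟩ | ⟨e, rfl⟩ := h.cover_ed e
    · rw [tgt_ed] at he
      exact h₁ e (h.inl_inj he)
    · rw [tgt_ed] at he
      obtain ⟨z, hz, hz'⟩ := h.exists_of_eq _ _ he.symm
      exact h₂ z hz e hz'.symm

theorem noOut_inl_iff (h : IsGluing f g inl inr) (x : X.left.Points) :
    P.NoOut (pt inl x) ↔ X.NoOut x ∧ ∀ z, pt f z = x → Y.NoOut (pt g z) := by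
  refine ⟨fun hx => ⟨hx.of_pt, ?_⟩, fun ⟨h₁, h₂⟩ e he => ?_⟩
  · rintro z rfl
    rw [h.pt_w] at hx
    exact hx.of_pt
  · obtain ⟨e, rfl⟩ | ⟨e, rfl⟩ := h.cover_ed e
    · rw [src_ed] at he
      exact h₁ e (h.inl_inj he)
    · rw [src_ed] at he
      obtain ⟨z, hz, hz'⟩ := h.exists_of_eq _ _ he.symm
      exact h₂ z hz e hz'.symm

/-- Since `hY` says that every input of `Y` is glued, no input of `P` lies outside the image of `X`.
-/
theorem inputs_eq (h : IsGluing f g inl inr) (hY : ∀ y ∈ Y.inputs, ∃ z, pt g z = y) :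
    P.inputs = pt inl '' {x | x ∈ X.inputs ∧ ∀ z, pt f z = x → Y.NoIn (pt g z)} := by
  ext p
  constructor
  · intro hp
    obtain ⟨x, rfl⟩ : ∃ x, pt inl x = p := by
      refine (h.cover p).elim id ?_
      rintro ⟨y, rfl⟩
      obtain ⟨z, rfl⟩ := hY y ⟨(isEdgePoint_pt inr y).1 hp.1, NoIn.of_pt inr hp.2⟩
      exact ⟨_, h.pt_w z⟩
    have hx := (h.noIn_inl_iff x).1 hp.2
    exact ⟨x, ⟨⟨(isEdgePoint_pt inl x).1 hp.1, hx.1⟩, hx.2⟩, rfl⟩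
  · rintro ⟨x, ⟨hx, hz⟩, rfl⟩
    exact ⟨(isEdgePoint_pt inl x).2 hx.1, (h.noIn_inl_iff x).2 ⟨hx.2, hz⟩⟩

theorem outputs_eq (h : IsGluing f g inl inr) (hY : ∀ y ∈ Y.outputs, ∃ z, pt g z = y) :
    P.outputs = pt inl '' {x | x ∈ X.outputs ∧ ∀ z, pt f z = x → Y.NoOut (pt g z)} := by
  ext p
  constructor
  · intro hp
    obtain ⟨x, rfl⟩ : ∃ x, pt inl x = p := by
      refine (h.cover p).elim id ?_
      rintro ⟨y, rfl⟩
      obtain ⟨z, rfl⟩ := hY y ⟨(isEdgePoint_pt inr y).1 hp.1, NoOut.of_pt inr hp.2⟩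
      exact ⟨_, h.pt_w z⟩
    have hx := (h.noOut_inl_iff x).1 hp.2
    exact ⟨x, ⟨⟨(isEdgePoint_pt inl x).1 hp.1, hx.1⟩, hx.2⟩, rfl⟩
  · rintro ⟨x, ⟨hx, hz⟩, rfl⟩
    exact ⟨(isEdgePoint_pt inl x).2 hx.1, (h.noOut_inl_iff x).2 ⟨hx.2, hz⟩⟩

/-- Glued points are edge-points, so no edge of `Y` touches a vertex of `X` and its neighbourhood is
unchanged in `P`. -/
theorem bijOn_nbhd_inl (h : IsGluing f g inl inr) (hZ : Z.IsDiscrete) (hX : X.IsLocalIso X.hom)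
    {x : X.left.Points} (hx : X.IsVertex x) :
    Set.BijOn (fun e : P.left.Edges => P.hom.app .zero e) (P.left.nbhd (pt inl x))
      ((typeGraph T).nbhd (P.hom.app .one (pt inl x))) := by
  have hne : ∀ y, pt inr y ≠ pt inl x := fun y hy => by
    obtain ⟨z, rfl, -⟩ := h.exists_of_eq _ _ hy.symm
    exact (hZ.edgePoint z).not_isVertex ((isVertex_pt f z).1 hx)
  have himage : P.left.nbhd (pt inl x) = ed inl '' X.left.nbhd x := by
    ext e
    constructor
    · intro he
      obtain ⟨e, rfl⟩ | ⟨e, rfl⟩ := h.cover_ed e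
      · refine ⟨e, ?_, rfl⟩
        rcases he with he | he
        · rw [src_ed] at he
          exact Or.inl (h.inl_inj he)
        · rw [tgt_ed] at he
          exact Or.inr (h.inl_inj he)
      · rcases he with he | he
        · rw [src_ed] at he
          exact absurd he (hne _)
        · rw [tgt_ed] at he
          exact absurd he (hne _)
    · rintro ⟨e, he | he, rfl⟩
      · exact Or.inl (by rw [src_ed, he])
      · exact Or.inr (by rw [tgt_ed, he])
  have htype : P.hom.app .one (pt inl x) = X.hom.app .one x := typeOf_pt inl x
  rw [himage, htype]
  have hb := hX x hx
  refine ⟨?_, ?_, fun t ht => ?_⟩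
  · rintro _ ⟨e, he, rfl⟩
    simpa only [hom_ed] using hb.mapsTo he
  · rintro _ ⟨e, he, rfl⟩ _ ⟨e', he', rfl⟩ hee
    simp only [hom_ed] at hee
    rw [hb.injOn he he' hee]
  · obtain ⟨e, he, rfl⟩ := hb.surjOn ht
    exact ⟨ed inl e, ⟨e, he, rfl⟩, hom_ed inl e⟩

theorem isOpen (h : IsGluing f g inl inr) (hZ : Z.IsDiscrete) (hX : X.IsOpen) (hY : Y.IsOpen)
    (hin : ∀ z, X.NoIn (pt f z) ∨ Y.NoIn (pt g z))
    (hout : ∀ z, X.NoOut (pt f z) ∨ Y.NoOut (pt g z)) : P.IsOpen where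
  localIso p hp := by
    obtain ⟨x, rfl⟩ | ⟨y, rfl⟩ := h.cover p
    · exact h.bijOn_nbhd_inl hZ hX.localIso ((isVertex_pt inl x).1 hp)
    · exact h.flip.bijOn_nbhd_inl hZ hY.localIso ((isVertex_pt inr y).1 hp)
  in_unique p hp e e' he he' := by
    -- Edges from different sides with a common target would meet at a glued point, where `hin`
    -- excludes one of them.
    have hmix : ∀ a b, P.left.tgt (ed inl a) = p → P.left.tgt (ed inr b) = p → False := by
      intro a b ha hb
      rw [tgt_ed] at ha hb
      obtain ⟨z, hz, hz'⟩ := h.exists_of_eq _ _ (ha.trans hb.symm)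
      exact (hin z).elim (fun H => H a hz.symm) fun H => H b hz'.symm
    obtain ⟨a, rfl⟩ | ⟨a, rfl⟩ := h.cover_ed e <;> obtain ⟨b, rfl⟩ | ⟨b, rfl⟩ := h.cover_ed e'
    · rw [tgt_ed] at he he'
      refine congrArg _ (hX.in_unique (X.left.tgt a) ?_ a b rfl (h.inl_inj (he'.trans he.symm)))
      rwa [← he, isEdgePoint_pt] at hp
    · exact (hmix _ _ he he').elim
    · exact (hmix _ _ he' he).elim
    · rw [tgt_ed] at he he'
      refine congrArg _ (hY.in_unique (Y.left.tgt a) ?_ a b rfl (h.inr_inj (he'.trans he.symm)))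
      rwa [← he, isEdgePoint_pt] at hp
  out_unique p hp e e' he he' := by
    have hmix : ∀ a b, P.left.src (ed inl a) = p → P.left.src (ed inr b) = p → False := by
      intro a b ha hb
      rw [src_ed] at ha hb
      obtain ⟨z, hz, hz'⟩ := h.exists_of_eq _ _ (ha.trans hb.symm)
      exact (hout z).elim (fun H => H a hz.symm) fun H => H b hz'.symm
    obtain ⟨a, rfl⟩ | ⟨a, rfl⟩ := h.cover_ed e <;> obtain ⟨b, rfl⟩ | ⟨b, rfl⟩ := h.cover_ed e'
    · rw [src_ed] at he he'
      refine congrArg _ (hX.out_unique (X.left.src a) ?_ a b rfl (h.inl_inj (he'.trans he.symm)))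
      rwa [← he, isEdgePoint_pt] at hp
    · exact (hmix _ _ he he').elim
    · exact (hmix _ _ he' he).elim
    · rw [src_ed] at he he'
      refine congrArg _ (hY.out_unique (Y.left.src a) ?_ a b rfl (h.inr_inj (he'.trans he.symm)))
      rwa [← he, isEdgePoint_pt] at hp

/-- The complement in a gluing is determined by the map into the gluing. -/
theorem exists_comparison {Y' : TGraph T} {g' : Z ⟶ Y'} {inr' : Y' ⟶ P}
    (h : IsGluing f g inl inr) (h' : IsGluing f g' inl inr') :
    ∃ φ : Y ⟶ Y', φ ≫ inr' = inr := by
  refine exists_factor inr' inr h'.inr_inj (fun y => ?_) (fun e => ?_)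
  -- A point of `Y` that also lies in `X` is glued, hence comes from `Z` and has a counterpart in
  -- `Y'`.
  · obtain ⟨x, hx⟩ | hy := h'.cover (pt inr y)
    · obtain ⟨z, rfl, rfl⟩ := h.exists_of_eq x y hx
      exact ⟨pt g' z, (h'.pt_w z).symm.trans hx⟩
    · exact hy
  · obtain ⟨x, hx⟩ | hy := h'.cover_ed (ed inr e)
    · exact absurd hx (h.ed_ne x e)
    · exact hy

end IsGluing

end TGraph

/-! ### Monomorphisms and point-graphs -/

open TGraph

theorem exists_map_pointGraph (G : OGraph T) (p : G.Points) (o : O) (hp : G.obj.typeOf p = .inl o) :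
    ∃ f : pointGraph T [o] ⟶ G, ∀ x, OGraph.onPoints f x = p :=
  ⟨ObjectProperty.homMk (mkHom (G := (pointGraph T [o]).obj) (fun _ => p) (fun e => PEmpty.elim e)
    (fun e => PEmpty.elim e) (fun e => PEmpty.elim e)
    (fun x => by
      obtain ⟨⟨i, hi⟩⟩ := x
      obtain rfl : i = 0 := by simpa using hi
      exact hp)
    (fun e => PEmpty.elim e)), fun _ => rfl⟩

/-- One-letter point-graphs are open and detect edge-points, so a monomorphism of open-graphs is
injective on these. This is all that is needed, since boundaries consist of edge-points. -/
theorem eq_of_mono {G H : OGraph T} (f : G ⟶ H) [Mono f] {p q : G.Points}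
    (hp : G.obj.IsEdgePoint p) (h : OGraph.onPoints f p = OGraph.onPoints f q) : p = q := by
  obtain ⟨o, ho⟩ := hp
  have hq : G.obj.typeOf q = .inl o := by
    rw [← ho, ← typeOf_pt f.hom p, ← typeOf_pt f.hom q]
    exact congrArg _ h.symm
  obtain ⟨a, ha⟩ := exists_map_pointGraph G p o ho
  obtain ⟨b, hb⟩ := exists_map_pointGraph G q o hq
  have hab : a = b := by
    rw [← cancel_mono f]
    apply ObjectProperty.hom_ext
    refine TGraph.hom_ext (fun x => ?_) (fun e => PEmpty.elim e)
    change OGraph.onPoints f (OGraph.onPoints a x) = OGraph.onPoints f (OGraph.onPoints b x)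
    rw [ha, hb, h]
  subst hab
  exact (ha ⟨0, Nat.zero_lt_one⟩).symm.trans (hb _)

theorem mono_of_injective {G H : OGraph T} (f : G ⟶ H) (hp : Function.Injective (pt f.hom))
    (he : Function.Injective (ed f.hom)) : Mono f :=
  (embedding T).mono_of_mono_map (TGraph.mono_of_injective f.hom hp he)

theorem isDiscrete_pointGraph (X : List O) : (pointGraph T X).obj.IsDiscrete where
  noEdges := ⟨fun e => PEmpty.elim e⟩
  edgePoint i := ⟨X.get i.down, rfl⟩

/-! ### Adhesive pushouts -/

section AdhesivePushout

variable {Z X Y P : OGraph T} {f : Z ⟶ X} {g : Z ⟶ Y} {inl : X ⟶ P} {inr : Y ⟶ P}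

theorem IsAdhesivePushout.of_preserved (h : IsPushout f.hom g.hom inl.hom inr.hom) :
    IsAdhesivePushout f g inl inr :=
  ⟨IsPushout.of_map_of_faithful (embedding T) h, h⟩

theorem IsAdhesivePushout.flip (h : IsAdhesivePushout f g inl inr) :
    IsAdhesivePushout g f inr inl :=
  ⟨h.isPushout.flip, h.preserved.flip⟩

/-- A pushout of two injective maps out of a discrete graph such that no in-edges and no out-edges
are brought together is open. -/
theorem exists_adhesivePushout (f : Z ⟶ X) (g : Z ⟶ Y) (hZ : Z.obj.IsDiscrete)
    (hf : Function.Injective (pt f.hom)) (hg : Function.Injective (pt g.hom))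
    (hin : ∀ z, X.obj.NoIn (pt f.hom z) ∨ Y.obj.NoIn (pt g.hom z))
    (hout : ∀ z, X.obj.NoOut (pt f.hom z) ∨ Y.obj.NoOut (pt g.hom z)) :
    ∃ (P : OGraph T) (inl : X ⟶ P) (inr : Y ⟶ P), IsAdhesivePushout f g inl inr := by
  have h := IsPushout.of_hasPushout f.hom g.hom
  exact ⟨⟨pushout f.hom g.hom, (hZ.isGluing hf hg h).isOpen hZ X.property Y.property hin hout⟩,
    ObjectProperty.homMk (pushout.inl _ _), ObjectProperty.homMk (pushout.inr _ _),
    .of_preserved h⟩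

/-- The pushout of typed graphs is open here, hence also a pushout of open-graphs; by uniqueness the
given pushout is isomorphic to it. -/
theorem isAdhesivePushout_of_isPushout (h : IsPushout f g inl inr) (hZ : Z.obj.IsDiscrete)
    (hf : Function.Injective (pt f.hom)) (hg : Function.Injective (pt g.hom))
    (hin : ∀ z, X.obj.NoIn (pt f.hom z) ∨ Y.obj.NoIn (pt g.hom z))
    (hout : ∀ z, X.obj.NoOut (pt f.hom z) ∨ Y.obj.NoOut (pt g.hom z)) :
    IsAdhesivePushout f g inl inr := by
  obtain ⟨P', inl', inr', h'⟩ := exists_adhesivePushout f g hZ hf hg hin hout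
  let e := h'.isPushout.isoIsPushout _ _ h
  refine ⟨h, h'.preserved.of_iso (Iso.refl _) (Iso.refl _) (Iso.refl _)
    ((embedding T).mapIso e) (by simp) (by simp) ?_ ?_⟩
  · rw [Functor.mapIso_hom, ← Functor.map_comp, h'.isPushout.inl_isoIsPushout_hom _ _ h]
    simp
  · rw [Functor.mapIso_hom, ← Functor.map_comp, h'.isPushout.inr_isoIsPushout_hom _ _ h]
    simp

theorem IsAdhesivePushout.isGluing (h : IsAdhesivePushout f g inl inr) (hZ : Z.obj.IsDiscrete)
    (hf : Function.Injective (pt f.hom)) (hg : Function.Injective (pt g.hom)) :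
    IsGluing f.hom g.hom inl.hom inr.hom :=
  hZ.isGluing hf hg h.preserved

end AdhesivePushout

/-! ### Pasting of pushouts -/

/-- If `G` is glued from `L` and `K`, and `K` and `G` are extended along the same maps, then the
extension of `G` is glued from `L` and the extension of `K`. -/
theorem isPushout_extend {C : Type*} [Category* C] {B L K G W H P K' : C}
    {b : B ⟶ L} {k : B ⟶ K} {m : L ⟶ G} {s : K ⟶ G} (hG : IsPushout b k m s)
    {c : W ⟶ K} {h : W ⟶ H} {i : G ⟶ P} {j : H ⟶ P} (hP : IsPushout (c ≫ s) h i j)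
    {t : K ⟶ K'} {r : H ⟶ K'} (hK : IsPushout c h t r) {v : K' ⟶ P}
    (hv₁ : t ≫ v = s ≫ i) (hv₂ : r ≫ v = j) : IsPushout b (k ≫ t) (m ≫ i) v := by
  subst hv₂
  -- Cancelling `hK` from `hP` leaves a pushout of `s` and `t`, which is pasted onto `hG`.
  exact hG.paste_vert (hP.of_left hv₁.symm hK)

theorem IsAdhesivePushout.extend {B L K G W H P K' : OGraph T}
    {b : B ⟶ L} {k : B ⟶ K} {m : L ⟶ G} {s : K ⟶ G} (hG : IsAdhesivePushout b k m s)
    {c : W ⟶ K} {h : W ⟶ H} {i : G ⟶ P} {j : H ⟶ P} (hP : IsAdhesivePushout (c ≫ s) h i j)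
    {t : K ⟶ K'} {r : H ⟶ K'} (hK : IsAdhesivePushout c h t r) {v : K' ⟶ P}
    (hv₁ : t ≫ v = s ≫ i) (hv₂ : r ≫ v = j) : IsAdhesivePushout b (k ≫ t) (m ≫ i) v :=
  .of_preserved (isPushout_extend hG.preserved hP.preserved hK.preserved
    (congrArg (fun a => a.hom) hv₁) (congrArg (fun a => a.hom) hv₂))

theorem exists_iso_of_isPushout {C : Type*} [Category* C] {B R K K' P P' : C}
    {b : B ⟶ R} {k : B ⟶ K} {k' : B ⟶ K'} {n : R ⟶ P} {s : K ⟶ P} {n' : R ⟶ P'} {s' : K' ⟶ P'}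
    (h : IsPushout b k n s) (h' : IsPushout b k' n' s') (φ : K ≅ K') (hφ : k ≫ φ.hom = k') :
    ∃ e : P ≅ P', s ≫ e.hom = φ.hom ≫ s' := by
  have h'' : IsPushout b k n' (φ.hom ≫ s') :=
    h'.of_iso (Iso.refl _) (Iso.refl _) φ.symm (Iso.refl _) (by simp) (by simp [← hφ]) (by simp)
      (by simp)
  exact ⟨h.isoIsPushout _ _ h'', h.inr_isoIsPushout_hom _ _ h''⟩

/-! ### Boundaries and complements of matches -/

/-- The map `b` identifies the discrete graph `B` with the boundary of `L`, and `I` with the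
inputs among it. -/
structure IsBoundary {B L : OGraph T} (b : B ⟶ L) (I : Set B.Points) : Prop where
  isDiscrete : B.obj.IsDiscrete
  injective : Function.Injective (pt b.hom)
  noIn_iff : ∀ z, L.obj.NoIn (pt b.hom z) ↔ z ∈ I
  noOut_iff : ∀ z, L.obj.NoOut (pt b.hom z) ↔ z ∉ I
  exists_of_input : ∀ x ∈ L.inputs, ∃ z, pt b.hom z = x
  exists_of_output : ∀ x ∈ L.outputs, ∃ z, pt b.hom z = x

/-- Since `b` is injective, the disjoint sets `I` and `Iᶜ` have disjoint images: no boundary point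
is both an input and an output of `L`. -/
theorem isBoundary_of_bijOn {B L : OGraph T} (b : B ⟶ L) [Mono b] (I : Set B.Points)
    (hB : IsEmpty B.Edges) (hI : Set.BijOn (OGraph.onPoints b) I L.inputs)
    (hI' : Set.BijOn (OGraph.onPoints b) Iᶜ L.outputs) : IsBoundary b I := by
  have hep : ∀ z, B.obj.IsEdgePoint z := fun z => by
    rw [← isEdgePoint_pt b.hom]
    by_cases hz : z ∈ I
    · exact (hI.mapsTo hz).1
    · exact (hI'.mapsTo hz).1
  have hinj : Function.Injective (pt b.hom) := fun z _ h => eq_of_mono b (hep z) h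
  refine ⟨⟨hB, hep⟩, hinj, fun z => ⟨fun h => ?_, fun h => (hI.mapsTo h).2⟩,
    fun z => ⟨fun h => ?_, fun h => (hI'.mapsTo h).2⟩, fun x hx => ?_, fun x hx => ?_⟩
  · obtain ⟨z', hz', hzz⟩ := hI.surjOn (show pt b.hom z ∈ L.inputs from
      ⟨(isEdgePoint_pt b.hom z).2 (hep z), h⟩)
    rwa [← hinj hzz]
  · obtain ⟨z', hz', hzz⟩ := hI'.surjOn (show pt b.hom z ∈ L.outputs from
      ⟨(isEdgePoint_pt b.hom z).2 (hep z), h⟩)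
    rwa [← hinj hzz]
  · obtain ⟨z, -, hz⟩ := hI.surjOn hx
    exact ⟨z, hz⟩
  · obtain ⟨z, -, hz⟩ := hI'.surjOn hx
    exact ⟨z, hz⟩

theorem RewriteRule.exists_isBoundary (ρ : RewriteRule T) :
    ∃ I : Set ρ.B.Points, IsBoundary ρ.b₁ I ∧ IsBoundary ρ.b₂ I := by
  obtain ⟨I, h₁, h₂, h₃, h₄⟩ := ρ.sameBoundary
  have := ρ.mono₁
  have := ρ.mono₂
  exact ⟨I, isBoundary_of_bijOn ρ.b₁ I ρ.noEdges h₁ h₂, isBoundary_of_bijOn ρ.b₂ I ρ.noEdges h₃ h₄⟩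

namespace IsBoundary

variable {B L K G : OGraph T} {b : B ⟶ L} {k : B ⟶ K} {m : L ⟶ G} {s : K ⟶ G} {I : Set B.Points}

theorem injective_complement (hb : IsBoundary b I) [Mono m] (h : IsPushout b k m s) :
    Function.Injective (pt k.hom) := by
  intro z z' hz
  have hw : ∀ x, pt m.hom (pt b.hom x) = pt s.hom (pt k.hom x) := fun x =>
    congrArg (fun a => pt a.hom x) h.w
  refine hb.injective (eq_of_mono m ((isEdgePoint_pt b.hom z).2 (hb.isDiscrete.edgePoint z)) ?_)
  exact (hw z).trans ((congrArg _ hz).trans (hw z').symm)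

theorem isGluing (hb : IsBoundary b I) [Mono m] (h : IsAdhesivePushout b k m s) :
    IsGluing b.hom k.hom m.hom s.hom :=
  h.isGluing hb.isDiscrete hb.injective (hb.injective_complement h.isPushout)

/-- The right-hand side does not mention `L`, so the same set of points of `K` describes the inputs
before and after rewriting. -/
theorem inputs_eq (hb : IsBoundary b I) (h : IsGluing b.hom k.hom m.hom s.hom) :
    G.inputs = pt s.hom '' {x | x ∈ K.inputs ∧ ∀ z, pt k.hom z = x → z ∈ I} := by
  simpa only [hb.noIn_iff] using h.flip.inputs_eq hb.exists_of_input

theorem outputs_eq (hb : IsBoundary b I) (h : IsGluing b.hom k.hom m.hom s.hom) :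
    G.outputs = pt s.hom '' {x | x ∈ K.outputs ∧ ∀ z, pt k.hom z = x → z ∉ I} := by
  simpa only [hb.noOut_iff] using h.flip.outputs_eq hb.exists_of_output

/-- A boundary input of `L` has an out-edge in `L`; an out-edge in `K` would be a second one in the
open-graph `G`. -/
theorem noOut_complement (hb : IsBoundary b I) (h : IsGluing b.hom k.hom m.hom s.hom)
    {z : B.Points} (hz : z ∈ I) : K.obj.NoOut (pt k.hom z) := by
  intro e he
  have hL : ¬ L.obj.NoOut (pt b.hom z) := fun hL => (hb.noOut_iff z).1 hL hz
  obtain ⟨e', he'⟩ := not_forall_not.1 hL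
  refine h.ed_ne e' e (G.property.out_unique (pt s.hom (pt k.hom z)) ?_ _ _ ?_ ?_)
  · rw [isEdgePoint_pt, isEdgePoint_pt]
    exact hb.isDiscrete.edgePoint z
  · rw [src_ed, he', h.pt_w]
  · rw [src_ed, he]

theorem noIn_complement (hb : IsBoundary b I) (h : IsGluing b.hom k.hom m.hom s.hom)
    {z : B.Points} (hz : z ∉ I) : K.obj.NoIn (pt k.hom z) := by
  intro e he
  have hL : ¬ L.obj.NoIn (pt b.hom z) := fun hL => hz ((hb.noIn_iff z).1 hL)
  obtain ⟨e', he'⟩ := not_forall_not.1 hL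
  refine h.ed_ne e' e (G.property.in_unique (pt s.hom (pt k.hom z)) ?_ _ _ ?_ ?_)
  · rw [isEdgePoint_pt, isEdgePoint_pt]
    exact hb.isDiscrete.edgePoint z
  · rw [tgt_ed, he', h.pt_w]
  · rw [tgt_ed, he]

/-- The complement of a match can be glued with any graph that has the same boundary. -/
theorem exists_adhesivePushout_replace {R : OGraph T} {b' : B ⟶ R} (hb : IsBoundary b I)
    (hb' : IsBoundary b' I) [Mono m] (h : IsAdhesivePushout b k m s) :
    ∃ (P : OGraph T) (n : R ⟶ P) (s' : K ⟶ P), IsAdhesivePushout b' k n s' := by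
  have hg := hb.isGluing h
  refine exists_adhesivePushout b' k hb.isDiscrete hb'.injective
    (hb.injective_complement h.isPushout) (fun z => ?_) (fun z => ?_)
  · by_cases hz : z ∈ I
    · exact Or.inl ((hb'.noIn_iff z).2 hz)
    · exact Or.inr (hb.noIn_complement hg hz)
  · by_cases hz : z ∈ I
    · exact Or.inr (hb.noOut_complement hg hz)
    · exact Or.inl ((hb'.noOut_iff z).2 hz)

/-- Adhesive pushout complements are unique. -/
theorem exists_iso_complement {K' : OGraph T} {k' : B ⟶ K'} {s' : K' ⟶ G} (hb : IsBoundary b I)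
    [Mono m] (h : IsAdhesivePushout b k m s) (h' : IsAdhesivePushout b k' m s') :
    ∃ φ : K ≅ K', k ≫ φ.hom = k' ∧ φ.hom ≫ s' = s := by
  have hg := hb.isGluing h
  have hg' := hb.isGluing h'
  have := mono_of_injective s hg.inr_inj hg.inr_inj_ed
  have := mono_of_injective s' hg'.inr_inj hg'.inr_inj_ed
  -- The comparison maps commute with the monomorphisms into `G`, so they are mutually inverse.
  obtain ⟨φ, hφ⟩ := hg.exists_comparison hg'
  obtain ⟨ψ, hψ⟩ := hg'.exists_comparison hg
  replace hφ : (ObjectProperty.homMk φ : K ⟶ K') ≫ s' = s := ObjectProperty.hom_ext _ hφ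
  replace hψ : (ObjectProperty.homMk ψ : K' ⟶ K) ≫ s = s' := ObjectProperty.hom_ext _ hψ
  refine ⟨⟨ObjectProperty.homMk φ, ObjectProperty.homMk ψ, ?_, ?_⟩, ?_, hφ⟩
  · rw [← cancel_mono s, Category.assoc, hψ, hφ, Category.id_comp]
  · rw [← cancel_mono s', Category.assoc, hφ, hψ, Category.id_comp]
  · rw [← cancel_mono s', Category.assoc, hφ, ← h.isPushout.w, h'.isPushout.w]

end IsBoundary

namespace DCospan

variable {W X Y Z : List O}

theorem Iso.refl (𝒢 : DCospan T X Y) : Iso 𝒢 𝒢 := ⟨CategoryTheory.Iso.refl _, by simp⟩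

theorem Iso.symm {𝒢 ℋ : DCospan T X Y} : Iso 𝒢 ℋ → Iso ℋ 𝒢 := by
  rintro ⟨e, h₁, h₂⟩
  exact ⟨e.symm, by simp [← h₁], by simp [← h₂]⟩

theorem injective_dom (𝒢 : DCospan T X Y) : Function.Injective (pt 𝒢.dom.hom) :=
  Set.injOn_univ.1 𝒢.dom_bij.injOn

theorem injective_cod (𝒢 : DCospan T X Y) : Function.Injective (pt 𝒢.cod.hom) :=
  Set.injOn_univ.1 𝒢.cod_bij.injOn

theorem noIn_dom (𝒢 : DCospan T X Y) (x : (pointGraph T X).Points) :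
    𝒢.graph.obj.NoIn (pt 𝒢.dom.hom x) := (𝒢.dom_bij.mapsTo (Set.mem_univ x)).2

theorem noOut_cod (𝒢 : DCospan T X Y) (y : (pointGraph T Y).Points) :
    𝒢.graph.obj.NoOut (pt 𝒢.cod.hom y) := (𝒢.cod_bij.mapsTo (Set.mem_univ y)).2

/-! ### Composition of cospans -/

section Composition

variable {𝒢 : DCospan T X Y} {ℋ : DCospan T Y Z} {P : OGraph T} {i : 𝒢.graph ⟶ P}
  {j : ℋ.graph ⟶ P}

theorem isAdhesivePushout_comp (h : IsPushout 𝒢.cod ℋ.dom i j) :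
    IsAdhesivePushout 𝒢.cod ℋ.dom i j :=
  isAdhesivePushout_of_isPushout h (isDiscrete_pointGraph Y) 𝒢.injective_cod ℋ.injective_dom
    (fun y => Or.inr (ℋ.noIn_dom y)) fun y => Or.inl (𝒢.noOut_cod y)

theorem isGluing_comp (h : IsPushout 𝒢.cod ℋ.dom i j) :
    IsGluing 𝒢.cod.hom ℋ.dom.hom i.hom j.hom :=
  (isAdhesivePushout_comp h).isGluing (isDiscrete_pointGraph Y) 𝒢.injective_cod ℋ.injective_dom

/-- All inputs of `ℋ` are glued, and being without in-edges they add none to the points of `𝒢`. -/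
theorem inputs_comp (h : IsPushout 𝒢.cod ℋ.dom i j) :
    P.inputs = pt i.hom '' 𝒢.graph.inputs := by
  have hy : ∀ y ∈ ℋ.graph.inputs, ∃ z, pt ℋ.dom.hom z = y := fun y hy => by
    obtain ⟨z, -, hz⟩ := ℋ.dom_bij.surjOn hy
    exact ⟨z, hz⟩
  simpa only [noIn_dom, implies_true, and_true] using! (isGluing_comp h).inputs_eq hy

theorem outputs_comp (h : IsPushout 𝒢.cod ℋ.dom i j) :
    P.outputs = pt j.hom '' ℋ.graph.outputs := by
  have hy : ∀ y ∈ 𝒢.graph.outputs, ∃ z, pt 𝒢.cod.hom z = y := fun y hy => by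
    obtain ⟨z, -, hz⟩ := 𝒢.cod_bij.surjOn hy
    exact ⟨z, hz⟩
  simpa only [noOut_cod, implies_true, and_true] using! (isGluing_comp h).flip.outputs_eq hy

theorem mono_inl_comp (h : IsPushout 𝒢.cod ℋ.dom i j) : Mono i :=
  mono_of_injective i (isGluing_comp h).inl_inj (isGluing_comp h).inl_inj_ed

theorem mono_inr_comp (h : IsPushout 𝒢.cod ℋ.dom i j) : Mono j :=
  mono_of_injective j (isGluing_comp h).inr_inj (isGluing_comp h).inr_inj_ed

theorem exists_isComp (𝒢 : DCospan T X Y) (ℋ : DCospan T Y Z) : ∃ 𝒦, IsComp 𝒢 ℋ 𝒦 := by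
  obtain ⟨P, i, j, h⟩ := exists_adhesivePushout 𝒢.cod ℋ.dom (isDiscrete_pointGraph Y)
    𝒢.injective_cod ℋ.injective_dom (fun y => Or.inr (ℋ.noIn_dom y))
    fun y => Or.inl (𝒢.noOut_cod y)
  have hg := isGluing_comp h.isPushout
  refine ⟨⟨P, 𝒢.dom ≫ i, ℋ.cod ≫ j, ?_, ?_⟩, i, j, h.isPushout, rfl, rfl⟩
  · rw [inputs_comp h.isPushout]
    exact hg.inl_inj.injOn.bijOn_image.comp 𝒢.dom_bij
  · rw [outputs_comp h.isPushout]
    exact hg.inr_inj.injOn.bijOn_image.comp ℋ.cod_bij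

theorem IsComp.unique {𝒦 𝒦' : DCospan T X Z} : IsComp 𝒢 ℋ 𝒦 → IsComp 𝒢 ℋ 𝒦' → Iso 𝒦 𝒦' := by
  rintro ⟨i, j, h, hd, hc⟩ ⟨i', j', h', hd', hc'⟩
  exact ⟨h.isoIsPushout _ _ h', by simp [hd, hd'], by simp [hc, hc']⟩

theorem IsComp.of_iso_left {𝒢' : DCospan T X Y} {𝒦 : DCospan T X Z} :
    IsComp 𝒢 ℋ 𝒦 → Iso 𝒢 𝒢' → IsComp 𝒢' ℋ 𝒦 := by
  rintro ⟨i, j, h, hd, hc⟩ ⟨e, he, he'⟩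
  refine ⟨e.inv ≫ i, j, ?_, by simp [hd, ← he], hc⟩
  exact h.of_iso (CategoryTheory.Iso.refl _) e (CategoryTheory.Iso.refl _)
    (CategoryTheory.Iso.refl _) (by simp [he']) (by simp) (by simp) (by simp)

theorem IsComp.of_iso_right {ℋ' : DCospan T Y Z} {𝒦 : DCospan T X Z} :
    IsComp 𝒢 ℋ 𝒦 → Iso ℋ ℋ' → IsComp 𝒢 ℋ' 𝒦 := by
  rintro ⟨i, j, h, hd, hc⟩ ⟨e, he, he'⟩
  refine ⟨i, e.inv ≫ j, ?_, hd, by simp [hc, ← he']⟩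
  exact h.of_iso (CategoryTheory.Iso.refl _) (CategoryTheory.Iso.refl _) e
    (CategoryTheory.Iso.refl _) (by simp) (by simp [he]) (by simp) (by simp)

theorem isComp_identity_left (𝒢 : DCospan T X Y) : IsComp (identity X) 𝒢 𝒢 :=
  ⟨𝒢.dom, 𝟙 _, IsPushout.of_id_fst, (Category.id_comp _).symm, (Category.comp_id _).symm⟩

theorem isComp_identity_right (𝒢 : DCospan T X Y) : IsComp 𝒢 (identity Y) 𝒢 :=
  ⟨𝟙 _, 𝒢.cod, IsPushout.of_id_snd, (Category.comp_id _).symm, (Category.id_comp _).symm⟩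

theorem IsComp.assoc {𝒢 : DCospan T W X} {ℋ : DCospan T X Y} {𝒥 : DCospan T Y Z}
    {𝒩 : DCospan T W Y} {𝒬 : DCospan T X Z} {ℛ : DCospan T W Z} :
    IsComp 𝒢 ℋ 𝒩 → IsComp 𝒩 𝒥 ℛ → IsComp ℋ 𝒥 𝒬 → IsComp 𝒢 𝒬 ℛ := by
  rintro ⟨i, j, h, hd, hc⟩ ⟨i', j', h', hd', hc'⟩ ⟨i'', j'', h'', hd'', hc''⟩
  rw [hc] at h'
  have hw : ℋ.cod ≫ j ≫ i' = 𝒥.dom ≫ j' := by rw [← h'.w, Category.assoc]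
  refine ⟨i ≫ i', h''.desc (j ≫ i') j' hw, ?_, ?_, ?_⟩
  -- Cancelling `h''` from `h'` leaves a pushout of `j` and `i''`, which is pasted onto `h`.
  · have hr := h'.of_left' h''
    rw [hd'']
    exact h.paste_vert hr
  · rw [hd', hd, Category.assoc]
  · rw [hc', hc'', Category.assoc, IsPushout.inr_desc]

theorem IsComp.noIsolatedPoints {𝒦 : DCospan T X Z} (h𝒢 : 𝒢.graph.NoIsolatedPoints) :
    IsComp 𝒢 ℋ 𝒦 → 𝒦.graph.NoIsolatedPoints := by
  rintro ⟨i, j, h, -, -⟩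
  have hg := isGluing_comp h
  refine Set.disjoint_left.2 fun p hp hp' => ?_
  rw [inputs_comp h] at hp
  rw [outputs_comp h] at hp'
  obtain ⟨x, hx, rfl⟩ := hp
  obtain ⟨y, -, hxy⟩ := hp'
  -- A point of both images is glued, so it is an output of `𝒢` as well as an input.
  obtain ⟨z, rfl, -⟩ := hg.exists_of_eq _ _ hxy.symm
  exact Set.disjoint_left.1 h𝒢 hx (𝒢.cod_bij.mapsTo (Set.mem_univ z))

end Composition

/-! ### Rewriting of cospans -/

section Rewriting

variable {ρ : RewriteRule T}

/-- Applied with `V` the inputs or the outputs of `G`, this lifts the legs of a cospan to the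
complement. -/
theorem exists_factor_complement {K G : OGraph T} (s : K ⟶ G)
    (hs : Function.Injective (pt s.hom)) {V : Set G.Points} (hV : V ⊆ Set.range (pt s.hom))
    (d : pointGraph T X ⟶ G) (hd : Set.MapsTo (OGraph.onPoints d) Set.univ V) :
    ∃ d' : pointGraph T X ⟶ K, d' ≫ s = d := by
  obtain ⟨φ, hφ⟩ := exists_factor s.hom d.hom hs (fun x => hV (hd (Set.mem_univ x)))
    (fun e => PEmpty.elim e)
  exact ⟨ObjectProperty.homMk φ, ObjectProperty.hom_ext _ hφ⟩

theorem bijOn_univ_transfer {α β γ δ : Type*} {d : α → β} {s : β → γ} {s' : β → δ} {S : Set β}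
    (hs : Function.Injective s) (hs' : Function.Injective s')
    (h : Set.BijOn (fun a => s (d a)) Set.univ (s '' S)) :
    Set.BijOn (fun a => s' (d a)) Set.univ (s' '' S) := by
  refine hs'.injOn.bijOn_image.comp ⟨fun a ha => ?_, fun a ha a' ha' haa => ?_, fun b hb => ?_⟩
  · obtain ⟨b, hb, hab⟩ := h.mapsTo ha
    rwa [← hs hab]
  · exact h.injOn ha ha' (congrArg s haa)
  · obtain ⟨a, ha, hab⟩ := h.surjOn (Set.mem_image_of_mem s hb)
    exact ⟨a, ha, hs hab⟩

theorem exists_isRewrite (ρ : RewriteRule T) (𝒢 : DCospan T X Y) (m : ρ.L ⟶ 𝒢.graph)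
    (hm : IsMatching ρ m) : ∃ 𝒢', IsRewrite ρ 𝒢 m 𝒢' := by
  obtain ⟨I, hb₁, hb₂⟩ := ρ.exists_isBoundary
  obtain ⟨_, K, k, s, h⟩ := id hm
  have hk := hb₁.injective_complement h.isPushout
  have hg := hb₁.isGluing h
  obtain ⟨P, n, s', h'⟩ := hb₁.exists_adhesivePushout_replace hb₂ h
  have hg' := h'.isGluing hb₂.isDiscrete hb₂.injective hk
  have hin := hb₁.inputs_eq hg
  have hout := hb₁.outputs_eq hg
  obtain ⟨d', hd'⟩ := exists_factor_complement s hg.inr_inj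
    (hin.subset.trans (Set.image_subset_range _ _)) 𝒢.dom 𝒢.dom_bij.mapsTo
  obtain ⟨c', hc'⟩ := exists_factor_complement s hg.inr_inj
    (hout.subset.trans (Set.image_subset_range _ _)) 𝒢.cod 𝒢.cod_bij.mapsTo
  have hd := 𝒢.dom_bij
  rw [← hd', hin] at hd
  have hc := 𝒢.cod_bij
  rw [← hc', hout] at hc
  refine ⟨⟨P, d' ≫ s', c' ≫ s', ?_, ?_⟩, hm, K, k, s, s', n, h, h', ⟨d', hd', rfl⟩, c', hc', rfl⟩
  · rw [hb₂.inputs_eq hg']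
    exact bijOn_univ_transfer hg.inr_inj hg'.inr_inj hd
  · rw [hb₂.outputs_eq hg']
    exact bijOn_univ_transfer hg.inr_inj hg'.inr_inj hc

theorem IsRewrite.unique {𝒢 𝒢' 𝒢'' : DCospan T X Y} {m : ρ.L ⟶ 𝒢.graph} :
    IsRewrite ρ 𝒢 m 𝒢' → IsRewrite ρ 𝒢 m 𝒢'' → Iso 𝒢' 𝒢'' := by
  rintro ⟨⟨_, -⟩, K₁, k₁, s₁, s₁', n₁, h₁, h₁', ⟨d₁, hd₁, hd₁'⟩, c₁, hc₁, hc₁'⟩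
    ⟨-, K₂, k₂, s₂, s₂', n₂, h₂, h₂', ⟨d₂, hd₂, hd₂'⟩, c₂, hc₂, hc₂'⟩
  obtain ⟨I, hb₁, -⟩ := ρ.exists_isBoundary
  have hg := hb₁.isGluing h₂
  have := mono_of_injective s₂ hg.inr_inj hg.inr_inj_ed
  obtain ⟨φ, hφk, hφs⟩ := hb₁.exists_iso_complement h₁ h₂
  obtain ⟨e, he⟩ := exists_iso_of_isPushout h₁'.isPushout h₂'.isPushout φ hφk
  have hd : d₁ ≫ φ.hom = d₂ := by rw [← cancel_mono s₂, Category.assoc, hφs, hd₁, hd₂]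
  have hc : c₁ ≫ φ.hom = c₂ := by rw [← cancel_mono s₂, Category.assoc, hφs, hc₁, hc₂]
  refine ⟨e, ?_, ?_⟩
  · rw [← hd₁', ← hd₂', Category.assoc, he, ← hd, Category.assoc]
  · rw [← hc₁', ← hc₂', Category.assoc, he, ← hc, Category.assoc]

theorem IsRewrite.noIsolatedPoints_iff {𝒢 𝒢' : DCospan T X Y} {m : ρ.L ⟶ 𝒢.graph} :
    IsRewrite ρ 𝒢 m 𝒢' → (𝒢.graph.NoIsolatedPoints ↔ 𝒢'.graph.NoIsolatedPoints) := by
  rintro ⟨⟨_, -⟩, K, k, s, s', n, h, h', -⟩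
  obtain ⟨I, hb₁, hb₂⟩ := ρ.exists_isBoundary
  have hg := hb₁.isGluing h
  have hg' := h'.isGluing hb₂.isDiscrete hb₂.injective (hb₁.injective_complement h.isPushout)
  rw [OGraph.NoIsolatedPoints, OGraph.NoIsolatedPoints, hb₁.inputs_eq hg, hb₁.outputs_eq hg,
    hb₂.inputs_eq hg', hb₂.outputs_eq hg', Set.disjoint_image_iff hg.inr_inj,
    Set.disjoint_image_iff hg'.inr_inj]

/-- Rewriting in the first cospan of a composite is rewriting in the composite. -/
theorem IsRewrite.comp_left {𝒢 𝒢' : DCospan T X Y} {ℋ : DCospan T Y Z} {𝒦 𝒦' : DCospan T X Z}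
    {m : ρ.L ⟶ 𝒢.graph} {i : 𝒢.graph ⟶ 𝒦.graph} {j : ℋ.graph ⟶ 𝒦.graph}
    (h : IsPushout 𝒢.cod ℋ.dom i j) (hd : 𝒦.dom = 𝒢.dom ≫ i) (hc : 𝒦.cod = ℋ.cod ≫ j) :
    IsRewrite ρ 𝒢 m 𝒢' → IsComp 𝒢' ℋ 𝒦' → IsRewrite ρ 𝒦 (m ≫ i) 𝒦' := by
  rintro ⟨⟨_, -⟩, K, k, s, s', n, hG, hG', ⟨d, hds, hds'⟩, c, hcs, hcs'⟩ ⟨i', j', h', hd', hc'⟩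
  have := mono_inl_comp h
  replace h := isAdhesivePushout_comp h
  replace h' := isAdhesivePushout_comp h'
  have hinj : Function.Injective (pt c.hom) := by
    have := 𝒢.injective_cod
    rw [← hcs] at this
    exact Function.Injective.of_comp (f := pt s.hom) this
  -- The complement in the composite, used for both `L` and `R`. It is open because points of `Y`
  -- have no out-edges in `K` and no in-edges in `ℋ`.
  obtain ⟨K', t, r, hK⟩ := exists_adhesivePushout c ℋ.dom (isDiscrete_pointGraph Y) hinj
    ℋ.injective_dom (fun y => Or.inr (ℋ.noIn_dom y)) fun y => Or.inl (NoOut.of_pt s.hom (by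
      have := 𝒢.noOut_cod y
      rwa [← hcs] at this))
  rw [← hcs] at h
  rw [← hcs'] at h'
  have hw : c ≫ s ≫ i = ℋ.dom ≫ j := by rw [← h.isPushout.w, Category.assoc]
  have hw' : c ≫ s' ≫ i' = ℋ.dom ≫ j' := by rw [← h'.isPushout.w, Category.assoc]
  have hv₁ := hK.isPushout.inl_desc (s ≫ i) j hw
  have hv₂ := hK.isPushout.inr_desc (s ≫ i) j hw
  have hv₁' := hK.isPushout.inl_desc (s' ≫ i') j' hw'
  have hv₂' := hK.isPushout.inr_desc (s' ≫ i') j' hw'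
  have hP := hG.extend h hK hv₁ hv₂
  have hP' := hG'.extend h' hK hv₁' hv₂'
  refine ⟨⟨inferInstance, _, _, _, hP⟩, K', k ≫ t, _, _, n ≫ i', hP, hP',
    ⟨d ≫ t, ?_, ?_⟩, ℋ.cod ≫ r, ?_, ?_⟩
  · rw [Category.assoc, hv₁, ← Category.assoc, hds, hd]
  · rw [Category.assoc, hv₁', ← Category.assoc, hds', hd']
  · rw [Category.assoc, hv₂, hc]
  · rw [Category.assoc, hv₂', hc']

/-- Rewriting in the second cospan of a composite is rewriting in the composite. -/
theorem IsRewrite.comp_right {𝒢 : DCospan T X Y} {ℋ ℋ' : DCospan T Y Z} {𝒦 𝒦' : DCospan T X Z}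
    {m : ρ.L ⟶ ℋ.graph} {i : 𝒢.graph ⟶ 𝒦.graph} {j : ℋ.graph ⟶ 𝒦.graph}
    (h : IsPushout 𝒢.cod ℋ.dom i j) (hd : 𝒦.dom = 𝒢.dom ≫ i) (hc : 𝒦.cod = ℋ.cod ≫ j) :
    IsRewrite ρ ℋ m ℋ' → IsComp 𝒢 ℋ' 𝒦' → IsRewrite ρ 𝒦 (m ≫ j) 𝒦' := by
  rintro ⟨⟨_, -⟩, K, k, s, s', n, hG, hG', ⟨d, hds, hds'⟩, c, hcs, hcs'⟩ ⟨i', j', h', hd', hc'⟩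
  have := mono_inr_comp h
  replace h := (isAdhesivePushout_comp h).flip
  replace h' := (isAdhesivePushout_comp h').flip
  have hinj : Function.Injective (pt d.hom) := by
    have := ℋ.injective_dom
    rw [← hds] at this
    exact Function.Injective.of_comp (f := pt s.hom) this
  -- Here `K` is extended by `𝒢` along its inputs: points of `Y` have no in-edges in `K` and no
  -- out-edges in `𝒢`.
  obtain ⟨K', t, r, hK⟩ := exists_adhesivePushout d 𝒢.cod (isDiscrete_pointGraph Y) hinj
    𝒢.injective_cod (fun y => Or.inl (NoIn.of_pt s.hom (by
      have := ℋ.noIn_dom y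
      rwa [← hds] at this))) fun y => Or.inr (𝒢.noOut_cod y)
  rw [← hds] at h
  rw [← hds'] at h'
  have hw : d ≫ s ≫ j = 𝒢.cod ≫ i := by rw [← h.isPushout.w, Category.assoc]
  have hw' : d ≫ s' ≫ j' = 𝒢.cod ≫ i' := by rw [← h'.isPushout.w, Category.assoc]
  have hv₁ := hK.isPushout.inl_desc (s ≫ j) i hw
  have hv₂ := hK.isPushout.inr_desc (s ≫ j) i hw
  have hv₁' := hK.isPushout.inl_desc (s' ≫ j') i' hw'
  have hv₂' := hK.isPushout.inr_desc (s' ≫ j') i' hw'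
  have hP := hG.extend h hK hv₁ hv₂
  have hP' := hG'.extend h' hK hv₁' hv₂'
  refine ⟨⟨inferInstance, _, _, _, hP⟩, K', k ≫ t, _, _, n ≫ j', hP, hP',
    ⟨𝒢.dom ≫ r, ?_, ?_⟩, c ≫ t, ?_, ?_⟩
  · rw [Category.assoc, hv₂, hd]
  · rw [Category.assoc, hv₂', hd']
  · rw [Category.assoc, hv₁, ← Category.assoc, hcs, hc]
  · rw [Category.assoc, hv₁', ← Category.assoc, hcs', hc']

theorem exists_matching_comp_left (ρ : RewriteRule T) (𝒢 : DCospan T X Y) (ℋ : DCospan T Y Z)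
    (m : ρ.L ⟶ 𝒢.graph) (hm : IsMatching ρ m) (𝒦 : DCospan T X Z) (h : IsComp 𝒢 ℋ 𝒦) :
    ∃ m' : ρ.L ⟶ 𝒦.graph, IsMatching ρ m' ∧
      ∀ 𝒢' 𝒦', IsRewrite ρ 𝒢 m 𝒢' → IsComp 𝒢' ℋ 𝒦' → IsRewrite ρ 𝒦 m' 𝒦' := by
  obtain ⟨i, j, h, hd, hc⟩ := h
  -- The choice of `𝒢'` and `𝒦'` serves only to see that `m ≫ i` is a matching; it does not affect
  -- `m ≫ i`.
  obtain ⟨𝒢', h𝒢'⟩ := exists_isRewrite ρ 𝒢 m hm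
  obtain ⟨𝒦', h𝒦'⟩ := exists_isComp 𝒢' ℋ
  exact ⟨m ≫ i, (h𝒢'.comp_left h hd hc h𝒦').1, fun _ _ h₁ h₂ => h₁.comp_left h hd hc h₂⟩

theorem exists_matching_comp_right (ρ : RewriteRule T) (𝒢 : DCospan T X Y) (ℋ : DCospan T Y Z)
    (n : ρ.L ⟶ ℋ.graph) (hn : IsMatching ρ n) (𝒦 : DCospan T X Z) (h : IsComp 𝒢 ℋ 𝒦) :
    ∃ n' : ρ.L ⟶ 𝒦.graph, IsMatching ρ n' ∧
      ∀ ℋ' 𝒦', IsRewrite ρ ℋ n ℋ' → IsComp 𝒢 ℋ' 𝒦' → IsRewrite ρ 𝒦 n' 𝒦' := by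
  obtain ⟨i, j, h, hd, hc⟩ := h
  obtain ⟨ℋ', hℋ'⟩ := exists_isRewrite ρ ℋ n hn
  obtain ⟨𝒦', h𝒦'⟩ := exists_isComp 𝒢 ℋ'
  exact ⟨n ≫ j, (hℋ'.comp_right h hd hc h𝒦').1, fun _ _ h₁ h₂ => h₁.comp_right h hd hc h₂⟩

end Rewriting

/-! ### Rewrite equivalence is a congruence -/

section Congruence

variable {𝕊 : Set (RewriteRule T)}

theorem RewriteEquiv.of_iso {𝒢 ℋ : DCospan T X Y} (h : Iso 𝒢 ℋ) : RewriteEquiv 𝕊 𝒢 ℋ :=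
  .rel _ _ (Or.inl h)

theorem RewriteEquiv.comp_left {𝒢 𝒢' : DCospan T X Y} (h : RewriteEquiv 𝕊 𝒢 𝒢')
    {ℋ : DCospan T Y Z} {𝒦 𝒦' : DCospan T X Z} (h𝒦 : IsComp 𝒢 ℋ 𝒦) (h𝒦' : IsComp 𝒢' ℋ 𝒦') :
    RewriteEquiv 𝕊 𝒦 𝒦' := by
  induction h generalizing 𝒦 𝒦' with
  | rel 𝒢 𝒢' h =>
    obtain h | ⟨ρ, hρ, m, 𝒢'', h, he⟩ := h
    · exact .of_iso ((h𝒦.of_iso_left h).unique h𝒦')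
    · obtain ⟨m', -, hm'⟩ := exists_matching_comp_left ρ 𝒢 ℋ m h.1 𝒦 h𝒦
      -- Transporting along `he`, `𝒦'` is also a composite of the rewritten cospan `𝒢''` with `ℋ`,
      -- hence itself a rewrite of `𝒦`.
      exact .rel _ _ (Or.inr ⟨ρ, hρ, m', 𝒦', hm' _ _ h (h𝒦'.of_iso_left he.symm), Iso.refl _⟩)
  | refl 𝒢 => exact .of_iso (h𝒦.unique h𝒦')
  | symm _ _ _ ih => exact .symm _ _ (ih h𝒦' h𝒦)
  | trans _ ℐ _ _ _ ih₁ ih₂ =>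
    obtain ⟨𝒥, h𝒥⟩ := exists_isComp ℐ ℋ
    exact .trans _ _ _ (ih₁ h𝒦 h𝒥) (ih₂ h𝒥 h𝒦')

theorem RewriteEquiv.comp_right {ℋ ℋ' : DCospan T Y Z} (h : RewriteEquiv 𝕊 ℋ ℋ')
    {𝒢 : DCospan T X Y} {𝒦 𝒦' : DCospan T X Z} (h𝒦 : IsComp 𝒢 ℋ 𝒦) (h𝒦' : IsComp 𝒢 ℋ' 𝒦') :
    RewriteEquiv 𝕊 𝒦 𝒦' := by
  induction h generalizing 𝒦 𝒦' with
  | rel ℋ ℋ' h =>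
    obtain h | ⟨ρ, hρ, n, ℋ'', h, he⟩ := h
    · exact .of_iso ((h𝒦.of_iso_right h).unique h𝒦')
    · obtain ⟨n', -, hn'⟩ := exists_matching_comp_right ρ 𝒢 ℋ n h.1 𝒦 h𝒦
      exact .rel _ _ (Or.inr ⟨ρ, hρ, n', 𝒦', hn' _ _ h (h𝒦'.of_iso_right he.symm), Iso.refl _⟩)
  | refl ℋ => exact .of_iso (h𝒦.unique h𝒦')
  | symm _ _ _ ih => exact .symm _ _ (ih h𝒦' h𝒦)
  | trans _ ℐ _ _ _ ih₁ ih₂ =>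
    obtain ⟨𝒥, h𝒥⟩ := exists_isComp 𝒢 ℐ
    exact .trans _ _ _ (ih₁ h𝒦 h𝒥) (ih₂ h𝒥 h𝒦')

theorem RewriteEquiv.comp {𝒢 𝒢' : DCospan T X Y} {ℋ ℋ' : DCospan T Y Z} {𝒦 𝒦' : DCospan T X Z}
    (h𝒢 : RewriteEquiv 𝕊 𝒢 𝒢') (hℋ : RewriteEquiv 𝕊 ℋ ℋ') (h𝒦 : IsComp 𝒢 ℋ 𝒦)
    (h𝒦' : IsComp 𝒢' ℋ' 𝒦') : RewriteEquiv 𝕊 𝒦 𝒦' := by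
  obtain ⟨𝒥, h𝒥⟩ := exists_isComp 𝒢' ℋ
  exact .trans _ _ _ (h𝒢.comp_left h𝒦 h𝒥) (hℋ.comp_right h𝒥 h𝒦')

end Congruence

end DCospan

/-! ### The rewrite category -/

namespace RewriteHom

open DCospan

variable {𝕊 : Set (RewriteRule T)} {X Y Z : List O}

/-- Composition in the rewrite category. -/
noncomputable def comp (f : RewriteHom 𝕊 X Y) (g : RewriteHom 𝕊 Y Z) : RewriteHom 𝕊 X Z :=
  Quotient.map₂ (fun 𝒢 ℋ => (exists_isComp 𝒢 ℋ).choose)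
    (fun _ _ h _ _ h' => RewriteEquiv.comp (𝕊 := 𝕊) h h' (exists_isComp _ _).choose_spec
      (exists_isComp _ _).choose_spec) f g

/-- Composites are unique up to isomorphism, so the one chosen in `comp` may be replaced by any
other. -/
theorem comp_mk {𝒢 : DCospan T X Y} {ℋ : DCospan T Y Z} {𝒦 : DCospan T X Z}
    (h : IsComp 𝒢 ℋ 𝒦) : comp (mk 𝕊 𝒢) (mk 𝕊 ℋ) = mk 𝕊 𝒦 :=
  Quotient.sound (RewriteEquiv.of_iso (𝕊 := 𝕊) ((exists_isComp 𝒢 ℋ).choose_spec.unique h))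

theorem exists_mk (f : RewriteHom 𝕊 X Y) : ∃ 𝒢, mk 𝕊 𝒢 = f := Quotient.exists_rep f

end RewriteHom

end TypedOpenGraph

open TypedOpenGraph DCospan in
theorem mainTheorem12 {O A : Type u} (T : A → List O × List O) :
    -- composites exist and are unique up to isomorphism of cospans
    (∀ {X Y Z : List O} (𝒢 : DCospan T X Y) (ℋ : DCospan T Y Z),
      (∃ 𝒦, IsComp 𝒢 ℋ 𝒦) ∧ ∀ 𝒦 𝒦', IsComp 𝒢 ℋ 𝒦 → IsComp 𝒢 ℋ 𝒦' → Iso 𝒦 𝒦') ∧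
    -- the rewritten cospan exists and is unique up to isomorphism of cospans
    (∀ {X Y : List O} (ρ : RewriteRule T) (𝒢 : DCospan T X Y) (m : ρ.L ⟶ 𝒢.graph),
      IsMatching ρ m →
      (∃ 𝒢', IsRewrite ρ 𝒢 m 𝒢') ∧
        ∀ 𝒢' 𝒢'', IsRewrite ρ 𝒢 m 𝒢' → IsRewrite ρ 𝒢 m 𝒢'' → Iso 𝒢' 𝒢'') ∧
    -- rewriting in the first cospan of a composite
    (∀ {X Y Z : List O} (ρ : RewriteRule T) (𝒢 : DCospan T X Y) (ℋ : DCospan T Y Z)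
      (m : ρ.L ⟶ 𝒢.graph), IsMatching ρ m → ∀ 𝒦, IsComp 𝒢 ℋ 𝒦 →
      ∃ m' : ρ.L ⟶ 𝒦.graph, IsMatching ρ m' ∧
        ∀ 𝒢' 𝒦' 𝒦'', IsRewrite ρ 𝒢 m 𝒢' → IsComp 𝒢' ℋ 𝒦' → IsRewrite ρ 𝒦 m' 𝒦'' →
          Iso 𝒦' 𝒦'') ∧
    -- rewriting in the second cospan of a composite
    (∀ {X Y Z : List O} (ρ : RewriteRule T) (𝒢 : DCospan T X Y) (ℋ : DCospan T Y Z)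
      (n : ρ.L ⟶ ℋ.graph), IsMatching ρ n → ∀ 𝒦, IsComp 𝒢 ℋ 𝒦 →
      ∃ n' : ρ.L ⟶ 𝒦.graph, IsMatching ρ n' ∧
        ∀ ℋ' 𝒦' 𝒦'', IsRewrite ρ ℋ n ℋ' → IsComp 𝒢 ℋ' 𝒦' → IsRewrite ρ 𝒦 n' 𝒦'' →
          Iso 𝒦' 𝒦'') ∧
    -- rewrite equivalence is a congruence for composition
    (∀ (𝕊 : Set (RewriteRule T)) {X Y Z : List O} (𝒢 𝒢' : DCospan T X Y)
      (ℋ ℋ' : DCospan T Y Z) (𝒦 𝒦' : DCospan T X Z),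
      RewriteEquiv 𝕊 𝒢 𝒢' → RewriteEquiv 𝕊 ℋ ℋ' → IsComp 𝒢 ℋ 𝒦 → IsComp 𝒢' ℋ' 𝒦' →
        RewriteEquiv 𝕊 𝒦 𝒦') ∧
    -- the rewrite category is well defined
    (∀ 𝕊 : Set (RewriteRule T),
      ∃ comp : ∀ {X Y Z : List O}, RewriteHom 𝕊 X Y → RewriteHom 𝕊 Y Z → RewriteHom 𝕊 X Z,
        (∀ {X Y Z : List O} (𝒢 : DCospan T X Y) (ℋ : DCospan T Y Z) (𝒦 : DCospan T X Z),
          IsComp 𝒢 ℋ 𝒦 → comp (.mk 𝕊 𝒢) (.mk 𝕊 ℋ) = .mk 𝕊 𝒦) ∧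
        (∀ {X Y : List O} (f : RewriteHom 𝕊 X Y), comp (.mk 𝕊 (identity X)) f = f) ∧
        (∀ {X Y : List O} (f : RewriteHom 𝕊 X Y), comp f (.mk 𝕊 (identity Y)) = f) ∧
        (∀ {W X Y Z : List O} (f : RewriteHom 𝕊 W X) (g : RewriteHom 𝕊 X Y)
          (h : RewriteHom 𝕊 Y Z), comp (comp f g) h = comp f (comp g h))) ∧
    -- composition and rewriting restrict to cospans of graphs without isolated points
    (∀ {X Y Z : List O} (𝒢 : DCospan T X Y) (ℋ : DCospan T Y Z) (𝒦 : DCospan T X Z),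
      𝒢.graph.NoIsolatedPoints → ℋ.graph.NoIsolatedPoints → IsComp 𝒢 ℋ 𝒦 →
        𝒦.graph.NoIsolatedPoints) ∧
    (∀ {X Y : List O} (ρ : RewriteRule T) (𝒢 : DCospan T X Y) (m : ρ.L ⟶ 𝒢.graph)
      (𝒢' : DCospan T X Y), IsRewrite ρ 𝒢 m 𝒢' →
        (𝒢.graph.NoIsolatedPoints ↔ 𝒢'.graph.NoIsolatedPoints)) := by
  refine ⟨fun 𝒢 ℋ => ⟨exists_isComp 𝒢 ℋ, fun _ _ => IsComp.unique⟩,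
    fun ρ 𝒢 m hm => ⟨exists_isRewrite ρ 𝒢 m hm, fun _ _ => IsRewrite.unique⟩,
    fun ρ 𝒢 ℋ m hm 𝒦 h => ?_, fun ρ 𝒢 ℋ n hn 𝒦 h => ?_,
    fun _ _ _ _ _ _ _ _ _ _ => RewriteEquiv.comp, fun 𝕊 => ?_,
    fun _ _ _ h𝒢 _ => IsComp.noIsolatedPoints h𝒢, fun _ _ _ _ => IsRewrite.noIsolatedPoints_iff⟩
  · obtain ⟨m', hm', H⟩ := exists_matching_comp_left ρ 𝒢 ℋ m hm 𝒦 h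
    exact ⟨m', hm', fun _ _ _ h₁ h₂ h₃ => (H _ _ h₁ h₂).unique h₃⟩
  · obtain ⟨n', hn', H⟩ := exists_matching_comp_right ρ 𝒢 ℋ n hn 𝒦 h
    exact ⟨n', hn', fun _ _ _ h₁ h₂ h₃ => (H _ _ h₁ h₂).unique h₃⟩
  · refine ⟨RewriteHom.comp, fun _ _ _ h => RewriteHom.comp_mk h, fun f => ?_, fun f => ?_,
      fun f g h => ?_⟩
    · obtain ⟨𝒢, rfl⟩ := f.exists_mk
      exact RewriteHom.comp_mk (isComp_identity_left 𝒢)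
    · obtain ⟨𝒢, rfl⟩ := f.exists_mk
      exact RewriteHom.comp_mk (isComp_identity_right 𝒢)
    · obtain ⟨𝒢, rfl⟩ := f.exists_mk
      obtain ⟨ℋ, rfl⟩ := g.exists_mk
      obtain ⟨𝒥, rfl⟩ := h.exists_mk
      obtain ⟨𝒩, h𝒩⟩ := exists_isComp 𝒢 ℋ
      obtain ⟨𝒬, h𝒬⟩ := exists_isComp ℋ 𝒥
      obtain ⟨ℛ, hℛ⟩ := exists_isComp 𝒩 𝒥
      beta_reduce
      rw [RewriteHom.comp_mk h𝒩, RewriteHom.comp_mk h𝒬, RewriteHom.comp_mk hℛ,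
        RewriteHom.comp_mk (h𝒩.assoc hℛ h𝒬)]
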